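/- **Setting.** Let $f:\mathbb R^n\to[-\infty,+\infty]$, $\mathcal M\subset\mathbb R^n$, $\bar x\in\mathbb R^n$. At a point $x$ with $f(x)$ finite, let $df(x)(w)=\liminf_{\tau\downarrow0,\,w'\to w}\frac{f(x+\tau w')-f(x)}{\tau}$ be the subderivative; let $\hat\partial f(x)$ be the set of $v$ with $\liminf_{y\to x,\,y\ne x}\frac{f(y)-f(x)-\langle v,y-x\rangle}{\|y-x\|}\ge0$; let $\partial f(x)$ be the set of limits of sequences $v^r\in\hat\partial f(x^r)$ with $x^r\to x$, $f(x^r)\to f(x)$; and let $\partial^\infty f(x)$ be the set of limits of $\lambda_r v^r$ with $v^r\in\partial f(x^r)$, $x^r\to x$, $f(x^r)\to f(x)$, $\lambda_r\downarrow0$ ($\lambda_r>0$). These sets are empty where $f$ is not finite. $f$ is *locally lsc* at such an $x$ if for some $\varepsilon>0$ the sets $\{y:\|y-x\|\le\varepsilon,\ f(y)\le\alpha\}$ are closed for all $\alpha\le f(x)+\varepsilon$. If $\partial f(x)\neq\emptyset$, $f$ is *regular* at $x$ if it is locally lsc at $x$, $\partial f(x)=\hat\partial f(x)$, and $\partial^\infty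 f(x)$ is the recession cone of $\hat\partial f(x)$. $f$ is *prox-regular* at $\bar x$ if for every $\bar v\in\partial f(\bar x)$: $f$ is finite and locally lsc at $\bar x$, and there are $\rho,\varepsilon>0$ such that $f(x')\ge f(x)+\langle v,x'-x\rangle-\frac\rho2\|x'-x\|^2$ whenever $\|x-\bar x\|<\varepsilon$, $\|x'-\bar x\|<\varepsilon$, $|f(x)-f(\bar x)|<\varepsilon$, $v\in\partial f(x)$ and $\|v-\bar v\|<\varepsilon$. $\mathcal M$ is a *manifold around* $\bar x$ if $\bar x\in\mathcal M$ and there are an open $V\ni\bar x$ and a $C^1$ map $\Phi:V\to\mathbb R^m$ (for some $m$) with surjective derivative throughout $V$ such that $\mathcal M\cap V=\{x\in V:\Phi(x)=0\}$; $N_{\mathcal M}(\bar x)$ is the orthogonal complement of its tangent space at $\bar x$. $f$ is *partly smooth* at $\bar x$ relative to $\mathcal M$ if $\mathcal M$ is a manifold around $\bar x$ and (i) near $\bar x$, $f|_{\mathcal M}$ is the restriction of a real-valued $C^1$ function; (ii) at every point of $\mathcal M$ close to $\bar x$, $f$ is finite, has a subgradient ($\partial f\ne\emptyset$) and is regular;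 (iii) $df(\bar x)(-w)>-df(\bar x)(w)$ for all nonzero $w\in N_{\mathcal M}(\bar x)$; (iv) $\partial f$ is continuous (outer and inner semicontinuous) at $\bar x$ relative to $\mathcal M$. **Theorem.** Let $f$ be partly smooth at $\bar x$ relative to $\mathcal M$ and prox-regular at $\bar x$, with $0$ in the relative interior of $\partial f(\bar x)$. Let $(x_k)$ be a sequence with $x_k\to\bar x$ and $f(x_k)\to f(\bar x)$. Then $x_k\in\mathcal M$ for all large $k$ if and only if $\mathrm{dist}(0,\partial f(x_k))\to0$ (where $\mathrm{dist}(0,\emptyset)=+\infty$). -/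

import Mathlib

open Filter Topology
open scoped ENNReal

noncomputable section

namespace VarAnalysis

/-- Finiteness of an extended real number. -/
def IsFinite (a : EReal) : Prop := a ≠ ⊤ ∧ a ≠ ⊥

variable {n : ℕ}

/-- The subderivative `df(x)(w) = liminf_{τ ↓ 0, w' → w} (f (x + τ w') - f x) / τ`
(meaningful where `f x` is finite). -/
def subderiv (f : EuclideanSpace ℝ (Fin n) → EReal) (x w : EuclideanSpace ℝ (Fin n)) : EReal :=
  liminf (fun p : ℝ × EuclideanSpace ℝ (Fin n) => (f (x + p.1 • p.2) - f x) / (p.1 : EReal))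
    ((𝓝[>] (0 : ℝ)) ×ˢ 𝓝 w)

/-- The regular (Fréchet) subdifferential; it is empty where `f` is not finite. -/
def regSubdiff (f : EuclideanSpace ℝ (Fin n) → EReal) (x : EuclideanSpace ℝ (Fin n)) :
    Set (EuclideanSpace ℝ (Fin n)) :=
  {v | IsFinite (f x) ∧
    0 ≤ liminf (fun y => (f y - f x - ((inner ℝ v (y - x) : ℝ) : EReal)) / ((‖y - x‖ : ℝ) : EReal))
      (𝓝[≠] x)}

/-- The limiting (Mordukhovich) subdifferential; it is empty where `f` is not finite. -/
def subdiff (f : EuclideanSpace ℝ (Fin n) → EReal) (x : EuclideanSpace ℝ (Fin n)) :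
    Set (EuclideanSpace ℝ (Fin n)) :=
  {v | IsFinite (f x) ∧ ∃ y u : ℕ → EuclideanSpace ℝ (Fin n),
    Tendsto y atTop (𝓝 x) ∧ Tendsto (fun r => f (y r)) atTop (𝓝 (f x)) ∧
    (∀ r, u r ∈ regSubdiff f (y r)) ∧ Tendsto u atTop (𝓝 v)}

/-- The horizon subdifferential. -/
def horizonSubdiff (f : EuclideanSpace ℝ (Fin n) → EReal) (x : EuclideanSpace ℝ (Fin n)) :
    Set (EuclideanSpace ℝ (Fin n)) :=
  {v | IsFinite (f x) ∧ ∃ (y u : ℕ → EuclideanSpace ℝ (Fin n)) (l : ℕ → ℝ),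
    Tendsto y atTop (𝓝 x) ∧ Tendsto (fun r => f (y r)) atTop (𝓝 (f x)) ∧
    (∀ r, u r ∈ subdiff f (y r)) ∧ (∀ r, 0 < l r) ∧ Tendsto l atTop (𝓝 0) ∧
    Tendsto (fun r => l r • u r) atTop (𝓝 v)}

/-- The recession cone of a convex set. -/
def recessionCone (C : Set (EuclideanSpace ℝ (Fin n))) : Set (EuclideanSpace ℝ (Fin n)) :=
  {w | ∀ v ∈ C, ∀ t : ℝ, 0 ≤ t → v + t • w ∈ C}

/-- Local lower semicontinuity at a point `x` where `f` is finite: for some `ε > 0`, the sublevel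
sets of `f` in the closed `ε`-ball about `x`, of level at most `f x + ε`, are closed. -/
def LocallyLscAt (f : EuclideanSpace ℝ (Fin n) → EReal) (x : EuclideanSpace ℝ (Fin n)) : Prop :=
  ∃ ε : ℝ, 0 < ε ∧ ∀ a : ℝ, (a : EReal) ≤ f x + (ε : EReal) →
    IsClosed {y | y ∈ Metric.closedBall x ε ∧ f y ≤ (a : EReal)}

/-- `f` is finite at `x`, has a subgradient there, and is (subdifferentially) regular at `x`. -/
def IsRegularWithSubgradient (f : EuclideanSpace ℝ (Fin n) → EReal)
    (x : EuclideanSpace ℝ (Fin n)) : Prop :=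
  IsFinite (f x) ∧ (subdiff f x).Nonempty ∧ LocallyLscAt f x ∧
    subdiff f x = regSubdiff f x ∧ horizonSubdiff f x = recessionCone (regSubdiff f x)

/-- `f` is prox-regular at `x` for the subgradient `v`. -/
def ProxRegularFor (f : EuclideanSpace ℝ (Fin n) → EReal) (x v : EuclideanSpace ℝ (Fin n)) : Prop :=
  IsFinite (f x) ∧ LocallyLscAt f x ∧
    ∃ ρ : ℝ, 0 < ρ ∧ ∃ ε : ℝ, 0 < ε ∧
      ∀ y ∈ Metric.ball x ε, ∀ y' ∈ Metric.ball x ε,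
        f x - (ε : EReal) < f y → f y < f x + (ε : EReal) →
          ∀ u ∈ subdiff f y, u ∈ Metric.ball v ε →
            f y + ((inner ℝ u (y' - y) - ρ / 2 * ‖y' - y‖ ^ 2 : ℝ) : EReal) ≤ f y'

/-- `f` is prox-regular at `x`: it is so for every subgradient at `x`. -/
def ProxRegularAt (f : EuclideanSpace ℝ (Fin n) → EReal) (x : EuclideanSpace ℝ (Fin n)) : Prop :=
  ∀ v ∈ subdiff f x, ProxRegularFor f x v

/-- `M` is a (`C¹`) manifold around `x`: near `x` it is the zero set of a `C¹` map whose
derivative is surjective. -/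
def IsManifoldAround (M : Set (EuclideanSpace ℝ (Fin n))) (x : EuclideanSpace ℝ (Fin n)) : Prop :=
  x ∈ M ∧ ∃ (m : ℕ) (V : Set (EuclideanSpace ℝ (Fin n)))
    (Φ : EuclideanSpace ℝ (Fin n) → EuclideanSpace ℝ (Fin m)),
    IsOpen V ∧ x ∈ V ∧ ContDiffOn ℝ 1 Φ V ∧
    (∀ y ∈ V, Function.Surjective (fderiv ℝ Φ y)) ∧ M ∩ V = {y | y ∈ V ∧ Φ y = 0}

/-- The normal space to the manifold `M` at `x`: the vectors orthogonal to all tangent vectors. -/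
def normalSpace (M : Set (EuclideanSpace ℝ (Fin n))) (x : EuclideanSpace ℝ (Fin n)) :
    Set (EuclideanSpace ℝ (Fin n)) :=
  {w | ∀ d ∈ tangentConeAt ℝ M x, inner ℝ w d = 0}

/-- The restriction of `f` to `M` is `C¹` around `x`. -/
def RestrictedSmoothAt (f : EuclideanSpace ℝ (Fin n) → EReal)
    (M : Set (EuclideanSpace ℝ (Fin n))) (x : EuclideanSpace ℝ (Fin n)) : Prop :=
  ∃ (U : Set (EuclideanSpace ℝ (Fin n))) (g : EuclideanSpace ℝ (Fin n) → ℝ),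
    IsOpen U ∧ x ∈ U ∧ ContDiffOn ℝ 1 g U ∧ ∀ y ∈ M ∩ U, f y = (g y : EReal)

/-- Continuity (outer and inner semicontinuity) of the set-valued map `F` at `x` relative
to `M`. -/
def SetContinuousRelAt (F : EuclideanSpace ℝ (Fin n) → Set (EuclideanSpace ℝ (Fin n)))
    (M : Set (EuclideanSpace ℝ (Fin n))) (x : EuclideanSpace ℝ (Fin n)) : Prop :=
  ∀ y : ℕ → EuclideanSpace ℝ (Fin n), (∀ r, y r ∈ M) → Tendsto y atTop (𝓝 x) →
    (∀ (u : ℕ → EuclideanSpace ℝ (Fin n)) (v : EuclideanSpace ℝ (Fin n)),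
      (∀ r, u r ∈ F (y r)) → Tendsto u atTop (𝓝 v) → v ∈ F x) ∧
    (∀ v ∈ F x, ∃ u : ℕ → EuclideanSpace ℝ (Fin n),
      (∀ᶠ r in atTop, u r ∈ F (y r)) ∧ Tendsto u atTop (𝓝 v))

/-- `f` is partly smooth at `x` relative to `M` (with `C¹` smoothness). -/
structure PartlySmoothAt (f : EuclideanSpace ℝ (Fin n) → EReal)
    (M : Set (EuclideanSpace ℝ (Fin n))) (x : EuclideanSpace ℝ (Fin n)) : Prop where
  manifold : IsManifoldAround M x
  restricted_smoothness : RestrictedSmoothAt f M x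
  regularity : ∀ᶠ y in 𝓝[M] x, IsRegularWithSubgradient f y
  normal_sharpness : ∀ w ∈ normalSpace M x, w ≠ 0 → -subderiv f x w < subderiv f x (-w)
  subgradient_continuity : SetContinuousRelAt (subdiff f) M x

end VarAnalysis

end

/-! If the points lie in `M`, inner semicontinuity of the subdifferential carries the subgradient 0
at the limit to subgradients tending to 0.

Conversely, let subgradients `v k` tend to 0 while infinitely many points stay off `M`. Project
these points onto `M`; along a subsequence the unit residuals converge to a unit normal `w`. Small
normal vectors are subgradients at the limit (`PartlySmoothAt.exists_normal_ball_subset`), so for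
small η > 0 the vector η w is a limit of subgradients at the projections. Prox-regularity makes the
subdifferential hypomonotone; dividing that inequality by the length of the residual and passing to
the limit gives η ≤ 0.

The normal ball exists because the subdifferential spans the normal space. It is normal since its
elements agree on tangent vectors and 0 is one of them. If a nonzero normal z were orthogonal to it,
the subderivative would be at most 0 along both z and -z (`subderiv_nonpos`), contradicting
sharpness. That bound rests on `exists_regSubgradient_of_growth`: growth along directions near z
yields nearby regular subgradients with positive component along z, whose limits, rescaled if
unbounded, are subgradients or horizon subgradients. -/

namespace VarAnalysis

/-! ### Regular subgradients and lower semicontinuous truncation -/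

variable {n : ℕ}

theorem IsFinite.coe_toReal {a : EReal} (h : IsFinite a) : ((a.toReal : ℝ) : EReal) = a :=
  EReal.coe_toReal h.1 h.2

/-- A difference quotient of an extended real number with finite base point is bounded below by
a real number if and only if the numerator satisfies the corresponding affine bound. -/
theorem coe_le_div_iff {b : EReal} {a s d c : ℝ} (hd : 0 < d) :
    (c : EReal) ≤ (b - (a : EReal) - (s : EReal)) / (d : EReal) ↔
      ((a + s + c * d : ℝ) : EReal) ≤ b := by
  rw [EReal.le_div_iff_mul_le (by exact_mod_cast hd) (EReal.coe_ne_top d)]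
  induction b with
  | bot =>
    simp only [EReal.bot_sub, le_bot_iff, EReal.coe_ne_bot, iff_false]
    exact_mod_cast EReal.coe_ne_bot (c * d)
  | top => simp
  | coe b =>
    norm_cast
    constructor <;> intro h <;> linarith

/-- A local quadratic minorant yields a regular subgradient. -/
theorem mem_regSubdiff_of_quadratic {f : EuclideanSpace ℝ (Fin n) → EReal}
    {x v : EuclideanSpace ℝ (Fin n)} {a K : ℝ} (ha : f x = a)
    (h : ∀ᶠ y in 𝓝 x, ((a + inner ℝ v (y - x) - K * ‖y - x‖ ^ 2 : ℝ) : EReal) ≤ f y) :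
    v ∈ regSubdiff f x := by
  refine ⟨by simp [ha, IsFinite], ?_⟩
  rw [ha]
  refine le_of_forall_lt fun c hc => ?_
  obtain ⟨q, hcq, hq0⟩ := EReal.lt_iff_exists_real_btwn.1 hc
  refine hcq.trans_le (le_liminf_of_le (by isBoundedDefault) ?_)
  have hq : q < 0 := by exact_mod_cast hq0
  have hlim : Tendsto (fun y => K * ‖y - x‖) (𝓝 x) (𝓝 0) := by
    have : Continuous fun y => K * ‖y - x‖ := by fun_prop
    simpa using this.tendsto x
  have hsmall : ∀ᶠ y in 𝓝 x, K * ‖y - x‖ < -q := hlim.eventually_lt_const (by linarith)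
  filter_upwards [nhdsWithin_le_nhds h, nhdsWithin_le_nhds hsmall, self_mem_nhdsWithin]
    with y hy hy' hne
  have hd : 0 < ‖y - x‖ := norm_pos_iff.2 (sub_ne_zero.2 hne)
  rw [coe_le_div_iff hd]
  refine le_trans ?_ hy
  norm_cast
  nlinarith

/-- The defining first-order minorization by a regular subgradient. -/
theorem eventually_le_of_mem_regSubdiff {f : EuclideanSpace ℝ (Fin n) → EReal}
    {x v : EuclideanSpace ℝ (Fin n)} {a : ℝ} (ha : f x = a) (hv : v ∈ regSubdiff f x)
    {ε : ℝ} (hε : 0 < ε) :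
    ∀ᶠ y in 𝓝 x, ((a + inner ℝ v (y - x) - ε * ‖y - x‖ : ℝ) : EReal) ≤ f y := by
  have h0 := hv.2
  rw [ha] at h0
  have hlt : ((-ε : ℝ) : EReal) < liminf (fun y => (f y - a - ((inner ℝ v (y - x) : ℝ) : EReal)) /
      ((‖y - x‖ : ℝ) : EReal)) (𝓝[≠] x) :=
    lt_of_lt_of_le (by exact_mod_cast neg_lt_zero.2 hε) h0
  have h := eventually_nhdsWithin_iff.1 (eventually_lt_of_lt_liminf hlt)
  filter_upwards [h] with y hy
  rcases eq_or_ne y x with rfl | hne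
  · simp [ha]
  · have hd : 0 < ‖y - x‖ := norm_pos_iff.2 (sub_ne_zero.2 hne)
    have := (coe_le_div_iff hd).1 (hy hne).le
    refine le_trans (le_of_eq ?_) this
    congr 1
    ring

theorem regSubdiff_subset_subdiff (f : EuclideanSpace ℝ (Fin n) → EReal)
    (x : EuclideanSpace ℝ (Fin n)) : regSubdiff f x ⊆ subdiff f x := fun v hv =>
  ⟨hv.1, fun _ => x, fun _ => v, tendsto_const_nhds, tendsto_const_nhds, fun _ => hv,
    tendsto_const_nhds⟩

/-- A locally lower semicontinuous function, truncated at a level slightly above its value at the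
reference point, is a real lower semicontinuous function near that point. -/
theorem LocallyLscAt.exists_truncation {f : EuclideanSpace ℝ (Fin n) → EReal}
    {x : EuclideanSpace ℝ (Fin n)} {a : ℝ} (ha : f x = a) (hf : LocallyLscAt f x) :
    ∃ r : ℝ, 0 < r ∧ ∃ g : EuclideanSpace ℝ (Fin n) → ℝ,
      LowerSemicontinuousOn g (Metric.closedBall x r) ∧
      ∀ y ∈ Metric.closedBall x r, (g y : EReal) = min (f y) ((a + r : ℝ) : EReal) := by
  obtain ⟨ε, hε, hcl⟩ := hf
  have hclosed : ∀ b : ℝ, b ≤ a + ε →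
      IsClosed {y | y ∈ Metric.closedBall x ε ∧ f y ≤ (b : EReal)} := by
    intro b hb
    refine hcl b ?_
    rw [ha]
    exact_mod_cast hb
  -- The sublevel set of level a - 1 is closed and misses x; this keeps the value -∞ away.
  have hlow : ∀ᶠ y in 𝓝 x, y ∈ Metric.closedBall x ε → ((a - 1 : ℝ) : EReal) < f y := by
    have hmem : x ∈ {y | y ∈ Metric.closedBall x ε ∧ f y ≤ ((a - 1 : ℝ) : EReal)}ᶜ := by
      rintro ⟨-, h⟩
      rw [ha] at h
      have : a ≤ a - 1 := by exact_mod_cast h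
      linarith
    filter_upwards [(hclosed (a - 1) (by linarith)).isOpen_compl.mem_nhds hmem] with y hy hyb
    by_contra hcon
    exact hy ⟨hyb, not_lt.1 hcon⟩
  obtain ⟨s, hs, hball⟩ := Metric.eventually_nhds_iff.1 hlow
  set r := min ε (s / 2) with hr
  have hr0 : 0 < r := lt_min hε (by linarith)
  have hrε : r ≤ ε := min_le_left _ _
  have hsub : Metric.closedBall x r ⊆ Metric.closedBall x ε := Metric.closedBall_subset_closedBall hrε
  have hgt : ∀ y ∈ Metric.closedBall x r, ((a - 1 : ℝ) : EReal) < f y := fun y hy =>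
    hball (by have : r ≤ s / 2 := min_le_right _ _
              have := Metric.mem_closedBall.1 hy; linarith) (hsub hy)
  have hg : ∀ y ∈ Metric.closedBall x r,
      (((min (f y) ((a + r : ℝ) : EReal)).toReal : ℝ) : EReal) =
        min (f y) ((a + r : ℝ) : EReal) := by
    intro y hy
    refine EReal.coe_toReal (ne_top_of_le_ne_top (EReal.coe_ne_top _) (min_le_right _ _)) ?_
    refine ne_of_gt (lt_min ((EReal.bot_lt_coe _).trans (hgt y hy)) (EReal.bot_lt_coe _))
  refine ⟨r, hr0, fun y => (min (f y) ((a + r : ℝ) : EReal)).toReal, ?_, hg⟩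
  intro y hy c hc
  have hc' : (c : EReal) < min (f y) ((a + r : ℝ) : EReal) := by
    rw [← hg y hy]
    exact_mod_cast hc
  have hcr : c < a + r := by exact_mod_cast hc'.trans_le (min_le_right _ _)
  have hmem : y ∈ {z | z ∈ Metric.closedBall x ε ∧ f z ≤ (c : EReal)}ᶜ := fun h =>
    absurd (hc'.trans_le (min_le_left _ _)) (not_lt.2 h.2)
  filter_upwards [mem_nhdsWithin_of_mem_nhds
    ((hclosed c (by linarith)).isOpen_compl.mem_nhds hmem), self_mem_nhdsWithin] with z hz hzr
  have : (c : EReal) < min (f z) ((a + r : ℝ) : EReal) :=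
    lt_min (not_le.1 fun h => hz ⟨hsub hzr, h⟩) (by exact_mod_cast hcr)
  rw [← hg z hzr] at this
  exact_mod_cast this

/-! ### Growth, subgradients and the subderivative -/

/-- Multidirectional mean value inequality, infinitesimal form: if `f` grows at least at rate
`c > 0` from `x` along all directions close to `w`, then there are regular subgradients `v` at
points arbitrarily close to `x` with `c / 2 + δ / 2 * ‖v‖ ≤ ⟪v, w⟫`. -/
theorem exists_regSubgradient_of_growth {f : EuclideanSpace ℝ (Fin n) → EReal}
    {x w : EuclideanSpace ℝ (Fin n)} {a c δ η : ℝ} (ha : f x = a) (hf : LocallyLscAt f x)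
    (hc : 0 < c) (hδ : 0 < δ) (hη : 0 < η)
    (hgrow : ∀ τ : ℝ, 0 < τ → τ ≤ δ → ∀ w' ∈ Metric.closedBall w δ,
      ((a + c * τ : ℝ) : EReal) ≤ f (x + τ • w')) :
    ∃ (p v : EuclideanSpace ℝ (Fin n)) (b : ℝ), ‖p - x‖ < η ∧ f p = b ∧ |b - a| < η ∧
      v ∈ regSubdiff f p ∧ c / 2 + δ / 2 * ‖v‖ ≤ inner ℝ v w := by
  obtain ⟨r, hr, g, hglsc, hg⟩ := hf.exists_truncation ha
  have hxK : x ∈ Metric.closedBall x r := Metric.mem_closedBall_self hr.le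
  have hgx : g x = a := by
    have h := hg x hxK
    rw [ha, min_eq_left (by exact_mod_cast (by linarith : a ≤ a + r))] at h
    exact_mod_cast h
  have hgle : ∀ y ∈ Metric.closedBall x r, (g y : EReal) ≤ f y := fun y hy => by
    rw [hg y hy]; exact min_le_left _ _
  have hlow : ∀ᶠ y in 𝓝 x, y ∈ Metric.closedBall x r → a - η < g y :=
    eventually_nhdsWithin_iff.1 (hglsc x hxK (a - η) (by simp only [hgx]; linarith))
  obtain ⟨s₀, hs₀, hlow⟩ := Metric.eventually_nhds_iff.1 hlow
  obtain ⟨z₀, hz₀, hmin⟩ :=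
    LowerSemicontinuousOn.exists_isMinOn ⟨x, hxK⟩ (isCompact_closedBall x r) hglsc
  set m := g z₀ with hm
  have hma : m ≤ a := hgx ▸ hmin hxK
  -- the length of the segment
  obtain ⟨t, ht, htδ, htr, htη, htw, htwη, htws⟩ : ∃ t : ℝ, 0 < t ∧ t ≤ δ ∧ c * t < r ∧ c * t < η ∧
      t * (‖w‖ + δ) < r ∧ t * (‖w‖ + δ) < η ∧ t * (‖w‖ + δ) < s₀ := by
    have h1 : Tendsto (fun t : ℝ => c * t) (𝓝[>] 0) (𝓝 0) := by
      have : Continuous fun t : ℝ => c * t := by fun_prop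
      simpa using (this.tendsto 0).mono_left nhdsWithin_le_nhds
    have h2 : Tendsto (fun t : ℝ => t * (‖w‖ + δ)) (𝓝[>] 0) (𝓝 0) := by
      have : Continuous fun t : ℝ => t * (‖w‖ + δ) := by fun_prop
      simpa using (this.tendsto 0).mono_left nhdsWithin_le_nhds
    have h3 : ∀ᶠ t : ℝ in 𝓝[>] 0, t ≤ δ :=
      nhdsWithin_le_nhds (eventually_le_nhds hδ)
    have h0 : ∀ᶠ t : ℝ in 𝓝[>] 0, 0 < t := self_mem_nhdsWithin
    exact (h0.and (h3.and ((h1.eventually_lt_const hr).and ((h1.eventually_lt_const hη).and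
      ((h2.eventually_lt_const hr).and ((h2.eventually_lt_const hη).and
        (h2.eventually_lt_const hs₀))))))).exists
  set D : ℝ := (δ / 2 * t) ^ 2 with hD
  have hD0 : 0 < D := by positivity
  set A : ℝ := a - m + c * t with hA
  have hA0 : 0 < A := by nlinarith [mul_pos hc ht]
  -- This weight bounds the residual `p - x - τ • e` by δt/2; the margin of A over a - m + ct/2
  -- excludes τ = t below.
  set κ : ℝ := A / D with hκ
  have hκ0 : 0 < κ := div_pos hA0 hD0
  have hκD : κ * D = A := div_mul_cancel₀ _ hD0.ne'
  -- minimization of the penalized function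
  set S : Set (EuclideanSpace ℝ (Fin n) × ℝ × EuclideanSpace ℝ (Fin n)) :=
    Metric.closedBall x r ×ˢ Set.Icc 0 t ×ˢ Metric.closedBall w (δ / 2) with hS
  have hScpt : IsCompact S :=
    (isCompact_closedBall x r).prod (isCompact_Icc.prod (isCompact_closedBall w (δ / 2)))
  have hwW : w ∈ Metric.closedBall w (δ / 2) := Metric.mem_closedBall_self (by linarith)
  have hbase : (x, (0 : ℝ), w) ∈ S := ⟨hxK, ⟨le_rfl, ht.le⟩, hwW⟩
  have hFlsc : LowerSemicontinuousOn
      (fun z : EuclideanSpace ℝ (Fin n) × ℝ × EuclideanSpace ℝ (Fin n) =>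
        g z.1 + (κ * ‖z.1 - x - z.2.1 • z.2.2‖ ^ 2 - c / 2 * z.2.1)) S := by
    refine LowerSemicontinuousOn.add ?_ ?_
    · exact hglsc.comp continuous_fst.continuousOn fun z hz => hz.1
    · exact (by fun_prop : Continuous fun
        z : EuclideanSpace ℝ (Fin n) × ℝ × EuclideanSpace ℝ (Fin n) =>
          κ * ‖z.1 - x - z.2.1 • z.2.2‖ ^ 2 - c / 2 * z.2.1).continuousOn.lowerSemicontinuousOn
  obtain ⟨⟨p, τ, e⟩, ⟨hpK, ⟨hτ0, hτt⟩, heW⟩, hFmin⟩ :=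
    LowerSemicontinuousOn.exists_isMinOn ⟨_, hbase⟩ hScpt hFlsc
  have hF : ∀ z ∈ Metric.closedBall x r, ∀ σ : ℝ, 0 ≤ σ → σ ≤ t →
      ∀ e' ∈ Metric.closedBall w (δ / 2),
      g p + (κ * ‖p - x - τ • e‖ ^ 2 - c / 2 * τ) ≤
        g z + (κ * ‖z - x - σ • e'‖ ^ 2 - c / 2 * σ) :=
    fun z hz σ hσ hσt e' he' => hFmin (show (z, σ, e') ∈ S from ⟨hz, ⟨hσ, hσt⟩, he'⟩)
  simp only at hpK hτ0 hτt heW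
  have hval : g p + (κ * ‖p - x - τ • e‖ ^ 2 - c / 2 * τ) ≤ a := by
    have := hF x hxK 0 le_rfl ht.le w hwW
    simpa [hgx] using this
  have hmp : m ≤ g p := hmin hpK
  have hcτ : c * τ ≤ c * t := mul_le_mul_of_nonneg_left hτt hc.le
  have hct : 0 < c * t := mul_pos hc ht
  have hew : ‖e - w‖ ≤ δ / 2 := by rw [← dist_eq_norm]; exact heW
  have hd : ‖p - x - τ • e‖ ≤ δ / 2 * t := by
    refine le_of_sq_le_sq ?_ (by positivity)
    refine le_of_mul_le_mul_left ?_ hκ0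
    rw [← hD, hκD]
    linarith
  have hpx : ‖p - x‖ ≤ t * (‖w‖ + δ) := by
    have he : ‖e‖ ≤ ‖w‖ + δ / 2 := by
      have := norm_le_norm_add_norm_sub' e w
      linarith
    have h1 : ‖τ • e‖ ≤ t * (‖w‖ + δ / 2) := by
      rw [norm_smul, Real.norm_of_nonneg hτ0]
      exact mul_le_mul hτt he (norm_nonneg _) ht.le
    have h2 : p - x = (p - x - τ • e) + τ • e := by abel
    have h3 := norm_add_le (p - x - τ • e) (τ • e)
    rw [← h2] at h3
    linarith
  have hgp : g p ≤ a + c / 2 * t := by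
    have : 0 ≤ κ * ‖p - x - τ • e‖ ^ 2 := by positivity
    linarith
  have hfp : f p = (g p : EReal) := by
    have h := hg p hpK
    rcases le_total (f p) ((a + r : ℝ) : EReal) with h' | h'
    · rw [h, min_eq_left h']
    · rw [min_eq_right h'] at h
      have : g p = a + r := by exact_mod_cast h
      linarith
  -- the minimizing parameter is not the endpoint
  have hτlt : τ < t := by
    refine lt_of_le_of_ne hτt fun hτ => ?_
    rw [hτ] at hval
    by_cases hcase : t⁻¹ • (p - x) ∈ Metric.closedBall w δ
    · have h := hgrow t ht htδ _ hcase
      rw [smul_inv_smul₀ ht.ne', add_sub_cancel, hfp] at h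
      have h' : a + c * t ≤ g p := by exact_mod_cast h
      linarith
    · rw [Metric.mem_closedBall, dist_eq_norm, not_le] at hcase
      have h1 : ‖t⁻¹ • (p - x) - w‖ ≤ ‖t⁻¹ • (p - x) - e‖ + ‖e - w‖ := norm_sub_le_norm_sub_add_norm_sub _ _ _
      have h2 : ‖p - x - t • e‖ = t * ‖t⁻¹ • (p - x) - e‖ := by
        rw [← Real.norm_of_nonneg ht.le, ← norm_smul, Real.norm_of_nonneg ht.le, smul_sub,
          smul_inv_smul₀ ht.ne']
      have h3 : δ / 2 * t ≤ ‖p - x - t • e‖ := by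
        rw [h2, mul_comm]
        exact mul_le_mul_of_nonneg_left (by linarith) ht.le
      have h4 : D ≤ ‖p - x - t • e‖ ^ 2 := pow_le_pow_left₀ (by positivity) h3 2
      have h5 := mul_le_mul_of_nonneg_left h4 hκ0.le
      linarith
  set d := p - x - τ • e with hd_def
  -- Minimality in the first variable makes minus the gradient of the penalty a regular subgradient.
  set v : EuclideanSpace ℝ (Fin n) := (2 * κ) • (-d) with hv
  have hvsub : v ∈ regSubdiff f p := by
    refine mem_regSubdiff_of_quadratic (K := κ) hfp ?_
    have hnhds : Metric.closedBall x r ∈ 𝓝 p := by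
      refine mem_of_superset (Metric.isOpen_ball.mem_nhds ?_) Metric.ball_subset_closedBall
      rw [Metric.mem_ball, dist_eq_norm]
      linarith
    filter_upwards [hnhds] with z hz
    refine le_trans ?_ (hgle z hz)
    have h := hF z hz τ hτ0 hτt e heW
    have h1 : z - x - τ • e = d + (z - p) := by rw [hd_def]; abel
    rw [h1, norm_add_sq_real] at h
    have h2 : inner ℝ v (z - p) = -(2 * κ * inner ℝ d (z - p)) := by
      rw [hv, real_inner_smul_left, inner_neg_left]; ring
    rw [h2]
    norm_cast
    linarith
  have hdir : ∀ e' ∈ Metric.closedBall w (δ / 2), c / 2 ≤ inner ℝ v e' := by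
    intro e' he'
    have hstep : ∀ᶠ s : ℝ in 𝓝[>] 0, c / 2 ≤ inner ℝ v e' + κ * s * ‖e'‖ ^ 2 := by
      have hst : ∀ᶠ s : ℝ in 𝓝[>] 0, s ≤ t - τ :=
        nhdsWithin_le_nhds (eventually_le_nhds (by linarith))
      filter_upwards [self_mem_nhdsWithin, hst] with s hs hst
      have hs : 0 < s := hs
      have hsum : 0 < τ + s := by linarith
      -- Weighted so that the path point τe moves to τe + se'; convexity keeps the direction
      -- admissible, even when τ = 0.
      have hconv : (τ / (τ + s)) • e + (s / (τ + s)) • e' ∈ Metric.closedBall w (δ / 2) :=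
        convex_closedBall w (δ / 2) heW he' (by positivity) (by positivity)
          (by field_simp)
      have h := hF p hpK (τ + s) hsum.le (by linarith) _ hconv
      have h1 : p - x - (τ + s) • ((τ / (τ + s)) • e + (s / (τ + s)) • e') = d - s • e' := by
        rw [smul_add, smul_smul, smul_smul, mul_div_cancel₀ _ hsum.ne',
          mul_div_cancel₀ _ hsum.ne', hd_def]
        abel
      rw [h1, norm_sub_sq_real d, real_inner_smul_right, norm_smul s e', Real.norm_of_nonneg hs.le,
        mul_pow] at h
      have h2 : inner ℝ v e' = -(2 * κ * inner ℝ d e') := by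
        rw [hv, real_inner_smul_left, inner_neg_left]; ring
      rw [h2]
      refine le_of_mul_le_mul_left ?_ hs
      nlinarith
    have hlim : Tendsto (fun s : ℝ => inner ℝ v e' + κ * s * ‖e'‖ ^ 2) (𝓝[>] 0)
        (𝓝 (inner ℝ v e')) := by
      have : Continuous fun s : ℝ => inner ℝ v e' + κ * s * ‖e'‖ ^ 2 := by fun_prop
      simpa using (this.tendsto 0).mono_left nhdsWithin_le_nhds
    exact ge_of_tendsto hlim hstep
  have hv0 : v ≠ 0 := by
    intro h0
    have := hdir w hwW
    rw [h0, inner_zero_left] at this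
    linarith
  have hvn : 0 < ‖v‖ := norm_pos_iff.2 hv0
  refine ⟨p, v, g p, by linarith, hfp, ?_, hvsub, ?_⟩
  · rw [abs_lt]
    have : a - η < g p := hlow (by rw [dist_eq_norm]; linarith) hpK
    constructor <;> linarith
  -- The worst direction in the ball turns its radius into the term δ/2 * ‖v‖.
  · have h := hdir (w - (δ / 2 / ‖v‖) • v) (by
      rw [Metric.mem_closedBall, dist_eq_norm, sub_sub_cancel_left, norm_neg, norm_smul,
        Real.norm_of_nonneg (by positivity), div_mul_cancel₀ _ hvn.ne'])
    rw [inner_sub_right, real_inner_smul_right, real_inner_self_eq_norm_sq] at h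
    have : δ / 2 / ‖v‖ * ‖v‖ ^ 2 = δ / 2 * ‖v‖ := by field_simp
    linarith

/-- A positive lower bound for the subderivative gives uniform growth along nearby directions. -/
theorem exists_growth_of_subderiv_pos {f : EuclideanSpace ℝ (Fin n) → EReal}
    {x w : EuclideanSpace ℝ (Fin n)} {a : ℝ} (ha : f x = a) (h : 0 < subderiv f x w) :
    ∃ c δ : ℝ, 0 < c ∧ 0 < δ ∧ ∀ τ : ℝ, 0 < τ → τ ≤ δ → ∀ w' ∈ Metric.closedBall w δ,
      ((a + c * τ : ℝ) : EReal) ≤ f (x + τ • w') := by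
  obtain ⟨c, hc0, hc⟩ := EReal.lt_iff_exists_real_btwn.1 h
  have hev := eventually_lt_of_lt_liminf hc
  rw [(nhdsGT_basis (0 : ℝ)).prod Metric.nhds_basis_closedBall |>.eventually_iff] at hev
  obtain ⟨⟨δ₁, δ₂⟩, ⟨h1, h2⟩, hev⟩ := hev
  simp only at h1 h2
  refine ⟨c, min (δ₁ / 2) δ₂, by exact_mod_cast hc0, lt_min (by linarith) h2, ?_⟩
  intro τ hτ hτδ w' hw'
  have hτ1 : τ < δ₁ := by
    have := hτδ.trans (min_le_left _ _)
    linarith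
  have hq := hev (x := (τ, w')) ⟨⟨hτ, hτ1⟩,
    Metric.closedBall_subset_closedBall (min_le_right _ _) hw'⟩
  simp only [ha] at hq
  have := (coe_le_div_iff (b := f (x + τ • w')) (a := a) (s := 0) hτ).1 (by simpa using hq.le)
  simpa using this

/-- The subderivative is nonpositive along directions orthogonal to all subgradients and horizon
subgradients. -/
theorem subderiv_nonpos {f : EuclideanSpace ℝ (Fin n) → EReal}
    {x w : EuclideanSpace ℝ (Fin n)} (hfin : IsFinite (f x)) (hf : LocallyLscAt f x)
    (hsub : ∀ v ∈ subdiff f x, inner ℝ v w ≤ (0 : ℝ))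
    (hhor : ∀ v ∈ horizonSubdiff f x, inner ℝ v w ≤ (0 : ℝ)) : subderiv f x w ≤ 0 := by
  by_contra hcon
  rw [not_le] at hcon
  obtain ⟨a, ha⟩ : ∃ a : ℝ, f x = a := ⟨_, hfin.coe_toReal.symm⟩
  obtain ⟨c, δ, hc, hδ, hgrow⟩ := exists_growth_of_subderiv_pos ha hcon
  choose p v b hp hb hba hv hvw using fun k : ℕ => exists_regSubgradient_of_growth ha hf hc hδ
    (Nat.one_div_pos_of_nat (n := k) (α := ℝ)) hgrow
  have hpx : Tendsto p atTop (𝓝 x) := by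
    rw [tendsto_iff_norm_sub_tendsto_zero]
    exact squeeze_zero (fun _ => norm_nonneg _) (fun k => (hp k).le)
      tendsto_one_div_add_atTop_nhds_zero_nat
  have hbl : Tendsto b atTop (𝓝 a) := by
    rw [tendsto_iff_norm_sub_tendsto_zero]
    exact squeeze_zero (fun _ => norm_nonneg _) (fun k => (hba k).le)
      tendsto_one_div_add_atTop_nhds_zero_nat
  have hfpx : Tendsto (fun k => f (p k)) atTop (𝓝 (f x)) := by
    simp only [hb, ha]
    exact (continuous_coe_real_ereal.tendsto a).comp hbl
  -- Unbounded norms: normalize, and the term δ/2 * ‖v‖ survives in a horizon subgradient. Otherwise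
  -- c/2 survives in a subgradient.
  by_cases hinf : Tendsto (fun k => ‖v k‖) atTop atTop
  · have hpos : ∀ k, 0 < ‖v k‖ := by
      intro k
      refine norm_pos_iff.2 fun h0 => ?_
      have := hvw k
      rw [h0, inner_zero_left, norm_zero] at this
      linarith
    obtain ⟨u, hu, φ, hφ, hlim⟩ := (isCompact_sphere (0 : EuclideanSpace ℝ (Fin n)) 1).tendsto_subseq
      (x := fun k => ‖v k‖⁻¹ • v k) (fun k => by
        simp [norm_smul, (hpos k).ne'])
    have hmem : u ∈ horizonSubdiff f x := by
      refine ⟨hfin, p ∘ φ, v ∘ φ, fun k => ‖v (φ k)‖⁻¹, hpx.comp hφ.tendsto_atTop,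
        hfpx.comp hφ.tendsto_atTop, fun k => regSubdiff_subset_subdiff f _ (hv _),
        fun k => inv_pos.2 (hpos _), ?_, hlim⟩
      exact (tendsto_inv_atTop_zero.comp hinf).comp hφ.tendsto_atTop
    have hge : δ / 2 ≤ inner ℝ u w := by
      refine ge_of_tendsto (hlim.inner tendsto_const_nhds) (Eventually.of_forall fun k => ?_)
      simp only [Function.comp_apply]
      rw [real_inner_smul_left, ← div_eq_inv_mul, le_div_iff₀ (hpos _)]
      have := hvw (φ k)
      linarith
    have := hhor u hmem
    linarith
  · rw [tendsto_atTop] at hinf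
    push Not at hinf
    obtain ⟨R, hR⟩ := hinf
    obtain ⟨u, -, φ, hφ, hlim⟩ := (isCompact_closedBall (0 : EuclideanSpace ℝ (Fin n)) R).tendsto_subseq'
      (x := v) (hR.mono fun k hk => by simpa using hk.le)
    have hmem : u ∈ subdiff f x :=
      ⟨hfin, p ∘ φ, v ∘ φ, hpx.comp hφ.tendsto_atTop, hfpx.comp hφ.tendsto_atTop,
        fun k => hv _, hlim⟩
    have hge : c / 2 ≤ inner ℝ u w := by
      refine ge_of_tendsto (hlim.inner tendsto_const_nhds) (Eventually.of_forall fun k => ?_)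
      have := hvw (φ k)
      have : 0 ≤ δ / 2 * ‖v (φ k)‖ := by positivity
      simp only [Function.comp_apply]
      linarith
    have := hsub u hmem
    linarith

/-! ### Tangent spaces, curves and nearest points -/

section Manifold

variable {E F : Type*} [NormedAddCommGroup E] [NormedSpace ℝ E]
  [NormedAddCommGroup F] [NormedSpace ℝ F]

/-- Tangent vectors to a set on which `Φ` vanishes are in the kernel of the derivative. -/
theorem tangentConeAt_subset_ker {Φ : E → F} {A : E →L[ℝ] F} {M : Set E} {x : E}
    (hΦ : HasFDerivAt Φ A x) (hx : Φ x = 0) (hM : ∀ᶠ y in 𝓝[M] x, Φ y = 0) :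
    ∀ d ∈ tangentConeAt ℝ M x, A d = 0 := by
  intro d hd
  have h0 : HasFDerivWithinAt Φ (0 : E →L[ℝ] F) M x :=
    (hasFDerivWithinAt_const (0 : F) x M).congr_of_eventuallyEq hM hx
  simpa using hΦ.hasFDerivWithinAt.unique_on h0 hd

/-- Every vector in the kernel of a surjective derivative is the velocity of a curve in the
zero set. -/
theorem exists_curve_of_mem_ker [CompleteSpace E] [FiniteDimensional ℝ F] {Φ : E → F}
    {A : E →L[ℝ] F} {x d : E} (hΦ : HasStrictFDerivAt Φ A x) (hA : Function.Surjective A)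
    (hx : Φ x = 0) (hd : A d = 0) :
    ∃ γ : ℝ → E, γ 0 = x ∧ HasDerivAt γ d 0 ∧ ∀ᶠ t in 𝓝 (0 : ℝ), Φ (γ t) = 0 := by
  have hr : A.range = ⊤ := LinearMap.range_eq_top.2 hA
  let d' : A.ker := ⟨d, hd⟩
  have hline : HasDerivAt (fun t : ℝ => t • d') d' 0 := by
    simpa using (hasDerivAt_id (0 : ℝ)).smul_const d'
  refine ⟨fun t => hΦ.implicitFunction Φ A hr (Φ x) (t • d'), ?_, ?_, ?_⟩
  · simp
  · have h := (hΦ.to_implicitFunction hr).hasFDerivAt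
    have h' : HasFDerivAt (hΦ.implicitFunction Φ A hr (Φ x)) A.ker.subtypeL ((0 : ℝ) • d') := by
      simpa using h
    simpa using! h'.comp_hasDerivAt (0 : ℝ) hline
  · have h := hΦ.map_implicitFunction_eq hr
    have hlim : Tendsto (fun t : ℝ => (Φ x, t • d')) (𝓝 0) (𝓝 (Φ x, 0)) := by
      have : Continuous fun t : ℝ => (Φ x, t • d') := by fun_prop
      simpa using this.tendsto 0
    filter_upwards [hlim.eventually h] with t ht
    rw [ht, hx]

/-- Kernels of surjective operators depend inner semicontinuously on the operator. -/
theorem exists_tendsto_mem_ker [FiniteDimensional ℝ F] {A : ℕ → E →L[ℝ] F} {B : E →L[ℝ] F}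
    (hAB : Tendsto A atTop (𝓝 B)) (hB : Function.Surjective B) {d : E} (hd : B d = 0) :
    ∃ e : ℕ → E, Tendsto e atTop (𝓝 d) ∧ ∀ᶠ k in atTop, A k (e k) = 0 := by
  have : CompleteSpace F := FiniteDimensional.complete ℝ F
  obtain ⟨S, hS⟩ := (B : E →ₗ[ℝ] F).exists_rightInverse_of_surjective (LinearMap.range_eq_top.2 hB)
  let T : F →L[ℝ] E := LinearMap.toContinuousLinearMap S
  have hBT : B.comp T = 1 := by
    ext y
    exact LinearMap.congr_fun hS y
  have hlim : Tendsto (fun k => (A k).comp T) atTop (𝓝 1) := by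
    rw [← hBT]
    exact ((((ContinuousLinearMap.compL ℝ F E F).flip T).continuous.tendsto B).comp hAB)
  have hunit : ∀ᶠ k in atTop, IsUnit ((A k).comp T) :=
    hlim.eventually (Units.isOpen.mem_nhds isUnit_one)
  have hinv : Tendsto (fun k => Ring.inverse ((A k).comp T)) atTop (𝓝 1) := by
    have := (NormedRing.inverse_continuousAt (1 : (F →L[ℝ] F)ˣ)).tendsto.comp hlim
    simpa [Function.comp_def] using this
  -- With `T` a right inverse of `B`, `A k ∘ T` tends to the identity and is eventually invertible;
  -- a Newton-type correction puts d into the kernel.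
  refine ⟨fun k => d - T (Ring.inverse ((A k).comp T) (A k d)), ?_, ?_⟩
  · have h1 : Tendsto (fun k => A k d) atTop (𝓝 0) := by
      rw [← hd]
      exact (isBoundedBilinearMap_apply.continuous.tendsto (B, d)).comp
        (hAB.prodMk_nhds tendsto_const_nhds)
    have h2 : Tendsto (fun k => Ring.inverse ((A k).comp T) (A k d)) atTop (𝓝 0) := by
      simpa [Function.comp_def] using
        (isBoundedBilinearMap_apply.continuous.tendsto ((1 : F →L[ℝ] F), (0 : F))).comp
          (hinv.prodMk_nhds h1)
    have h3 : Tendsto (fun k => T (Ring.inverse ((A k).comp T) (A k d))) atTop (𝓝 0) := by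
      simpa [Function.comp_def] using (T.continuous.tendsto 0).comp h2
    simpa using (tendsto_const_nhds (x := d)).sub h3
  · filter_upwards [hunit] with k hk
    have := congrArg (fun R : F →L[ℝ] F => R (A k d)) (Ring.mul_inverse_cancel _ hk)
    simp only [mul_apply_eq_comp, ContinuousLinearMap.comp_apply,
      one_apply_eq_self] at this
    rw [map_sub, this, sub_self]

end Manifold

section Euclidean

variable {E F : Type*} [NormedAddCommGroup E] [InnerProductSpace ℝ E] [CompleteSpace E]
  [NormedAddCommGroup F] [NormedSpace ℝ F] [FiniteDimensional ℝ F]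

/-- The residual of a local nearest point in a zero set is normal to it. -/
theorem inner_sub_eq_zero_of_nearest {Φ : E → F} {A : E →L[ℝ] F} {p y d : E}
    (hΦ : HasStrictFDerivAt Φ A p) (hA : Function.Surjective A) (hp : Φ p = 0) (hd : A d = 0)
    (hmin : ∀ᶠ z in 𝓝 p, Φ z = 0 → dist y p ≤ dist y z) : inner ℝ (y - p) d = (0 : ℝ) := by
  obtain ⟨γ, hγ0, hγ, hγM⟩ := exists_curve_of_mem_ker hΦ hA hp hd
  have hder : HasDerivAt (fun t => ‖y - γ t‖ ^ 2) (2 * inner ℝ (y - γ 0) (-d)) 0 := by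
    simpa using (hγ.const_sub y).norm_sq
  have hmin' : IsLocalMin (fun t => ‖y - γ t‖ ^ 2) 0 := by
    have hc : Tendsto γ (𝓝 0) (𝓝 p) := hγ0 ▸ hγ.continuousAt.tendsto
    filter_upwards [hγM, hc.eventually hmin] with t ht ht'
    have := ht' ht
    rw [dist_eq_norm, dist_eq_norm] at this
    rw [hγ0]
    gcongr
  have := hmin'.hasDerivAt_eq_zero hder
  rw [hγ0, inner_neg_right] at this
  linarith

end Euclidean

/-- The tangent space of a manifold: it contains the tangent cone, consists of velocities of
curves in the manifold, and nearby points have nearest points in the manifold whose residuals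
have directions asymptotically orthogonal to it. -/
theorem IsManifoldAround.exists_tangentSpace {M : Set (EuclideanSpace ℝ (Fin n))}
    {x : EuclideanSpace ℝ (Fin n)} (hM : IsManifoldAround M x) :
    ∃ K : Submodule ℝ (EuclideanSpace ℝ (Fin n)),
      tangentConeAt ℝ M x ⊆ K ∧
      (∀ d ∈ K, ∃ γ : ℝ → EuclideanSpace ℝ (Fin n), γ 0 = x ∧ HasDerivAt γ d 0 ∧
        ∀ᶠ t in 𝓝 (0 : ℝ), γ t ∈ M) ∧
      ∀ y : ℕ → EuclideanSpace ℝ (Fin n), Tendsto y atTop (𝓝 x) →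
        ∃ p : ℕ → EuclideanSpace ℝ (Fin n), (∀ k, p k ∈ M) ∧ Tendsto p atTop (𝓝 x) ∧
          ∀ (φ : ℕ → ℕ) (s : ℕ → ℝ) (w : EuclideanSpace ℝ (Fin n)), StrictMono φ →
            Tendsto (fun k => s k • (y (φ k) - p (φ k))) atTop (𝓝 w) → w ∈ Kᗮ := by
  obtain ⟨hxM, m, V, Φ, hV, hxV, hΦ, hsurj, hMV⟩ := hM
  have hstrict : ∀ z ∈ V, HasStrictFDerivAt Φ (fderiv ℝ Φ z) z := fun z hz =>
    (hΦ.contDiffAt (hV.mem_nhds hz)).hasStrictFDerivAt one_ne_zero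
  have hmemM : ∀ z ∈ V, (z ∈ M ↔ Φ z = 0) := fun z hz =>
    ⟨fun h => ((Set.ext_iff.1 hMV z).1 ⟨h, hz⟩).2, fun h => ((Set.ext_iff.1 hMV z).2 ⟨hz, h⟩).1⟩
  have hΦx : Φ x = 0 := (hmemM x hxV).1 hxM
  have hVx : ∀ᶠ z in 𝓝 x, z ∈ V := hV.mem_nhds hxV
  refine ⟨(fderiv ℝ Φ x).ker, ?_, ?_, ?_⟩
  · intro d hd
    refine tangentConeAt_subset_ker (hstrict x hxV).hasFDerivAt hΦx ?_ d hd
    filter_upwards [self_mem_nhdsWithin, nhdsWithin_le_nhds hVx] with z hz hzV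
    exact (hmemM z hzV).1 hz
  · intro d hd
    obtain ⟨γ, hγ0, hγ, hγM⟩ := exists_curve_of_mem_ker (hstrict x hxV) (hsurj x hxV) hΦx hd
    refine ⟨γ, hγ0, hγ, ?_⟩
    have hc : Tendsto γ (𝓝 0) (𝓝 x) := hγ0 ▸ hγ.continuousAt.tendsto
    filter_upwards [hγM, hc.eventually hVx] with t ht htV
    exact (hmemM _ htV).2 ht
  · intro y hy
    obtain ⟨R, hR, hball⟩ := Metric.nhds_basis_closedBall.mem_iff.1 (hV.mem_nhds hxV)
    have hCcl : IsClosed (Metric.closedBall x R ∩ Φ ⁻¹' {0}) :=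
      (hΦ.continuousOn.mono hball).preimage_isClosed_of_isClosed Metric.isClosed_closedBall
        isClosed_singleton
    have hxC : x ∈ Metric.closedBall x R ∩ Φ ⁻¹' {0} := ⟨Metric.mem_closedBall_self hR.le, hΦx⟩
    choose p hpC hpd using fun k => hCcl.exists_infDist_eq_dist ⟨x, hxC⟩ (y k)
    have hnear : ∀ k, ∀ z ∈ Metric.closedBall x R ∩ Φ ⁻¹' {0}, dist (y k) (p k) ≤ dist (y k) z :=
      fun k z hz => hpd k ▸ Metric.infDist_le_dist_of_mem hz
    have hpx : Tendsto p atTop (𝓝 x) := by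
      have hyx : Tendsto (fun k => 2 * dist (y k) x) atTop (𝓝 0) := by
        simpa using (tendsto_iff_dist_tendsto_zero.1 hy).const_mul 2
      refine tendsto_iff_dist_tendsto_zero.2 (squeeze_zero (fun _ => dist_nonneg) (fun k => ?_) hyx)
      have h1 := hnear k x hxC
      have h2 := dist_triangle (p k) (y k) x
      rw [dist_comm (p k) (y k)] at h2
      linarith
    refine ⟨p, fun k => (hmemM _ (hball (hpC k).1)).2 (hpC k).2, hpx, ?_⟩
    intro φ s w hφ hw
    rw [Submodule.mem_orthogonal']
    intro d hd
    have hpφ : Tendsto (p ∘ φ) atTop (𝓝 x) := hpx.comp hφ.tendsto_atTop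
    have hA : Tendsto (fun k => fderiv ℝ Φ (p (φ k))) atTop (𝓝 (fderiv ℝ Φ x)) :=
      (((hΦ.continuousOn_fderiv_of_isOpen hV le_rfl).continuousAt
        (hV.mem_nhds hxV)).tendsto).comp hpφ
    -- The residual at `p (φ k)` is exactly orthogonal to the tangent vectors `e k` there, and these
    -- converge to `d`.
    obtain ⟨e, he, heA⟩ := exists_tendsto_mem_ker hA (hsurj x hxV) hd
    have hlim := hw.inner (𝕜 := ℝ) he
    refine tendsto_nhds_unique hlim (tendsto_const_nhds.congr' ?_)
    have hint : ∀ᶠ k in atTop, p (φ k) ∈ Metric.ball x R :=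
      hpφ.eventually (Metric.ball_mem_nhds x hR)
    filter_upwards [heA, hint] with k hk hkR
    have hkV : p (φ k) ∈ V := hball (hpC _).1
    have := inner_sub_eq_zero_of_nearest (y := y (φ k)) (hstrict _ hkV) (hsurj _ hkV) (hpC _).2 hk (by
      filter_upwards [Metric.isOpen_ball.mem_nhds hkR] with z hz hz0
      exact hnear _ z ⟨Metric.ball_subset_closedBall hz, hz0⟩)
    rw [real_inner_smul_left, this, mul_zero]

/-! ### Subgradients and the normal space -/

/-- A regular subgradient acts on velocities of curves along which `f` is smooth as an
underestimate of the derivative. -/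
theorem inner_le_of_mem_regSubdiff {f : EuclideanSpace ℝ (Fin n) → EReal}
    {g : EuclideanSpace ℝ (Fin n) → ℝ} {g' : EuclideanSpace ℝ (Fin n) →L[ℝ] ℝ}
    {x v d : EuclideanSpace ℝ (Fin n)} {γ : ℝ → EuclideanSpace ℝ (Fin n)} (hv : v ∈ regSubdiff f x)
    (hg : HasFDerivAt g g' x) (hγ0 : γ 0 = x) (hγ : HasDerivAt γ d 0)
    (hfg : ∀ᶠ t in 𝓝 (0 : ℝ), f (γ t) = g (γ t)) : inner ℝ v d ≤ g' d := by
  have hfx : f x = g x := by have := hfg.self_of_nhds; rwa [hγ0] at this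
  have hc : Tendsto γ (𝓝 0) (𝓝 x) := hγ0 ▸ hγ.continuousAt.tendsto
  have hgγ : HasDerivAt (fun t => g (γ t)) (g' d) 0 := by
    subst hγ0
    exact hg.comp_hasDerivAt (0 : ℝ) hγ
  have hs1 := hγ.tendsto_slope_zero_right
  have hs2 := hgγ.tendsto_slope_zero_right
  simp only [zero_add, hγ0] at hs1 hs2
  have key : ∀ ε > 0, inner ℝ v d - ε * ‖d‖ ≤ g' d := by
    intro ε hε
    have hlim := ((tendsto_const_nhds (x := v)).inner (𝕜 := ℝ) hs1).sub (hs1.norm.const_mul ε)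
    refine le_of_tendsto_of_tendsto hlim hs2 ?_
    filter_upwards [self_mem_nhdsWithin, nhdsWithin_le_nhds hfg, nhdsWithin_le_nhds
      (hc.eventually (eventually_le_of_mem_regSubdiff hfx hv hε))] with t ht htfg htv
    have ht : 0 < t := ht
    rw [htfg] at htv
    have h : g x + inner ℝ v (γ t - x) - ε * ‖γ t - x‖ ≤ g (γ t) := by exact_mod_cast htv
    rw [real_inner_smul_right, norm_smul, Real.norm_of_nonneg (inv_nonneg.2 ht.le), smul_eq_mul]
    have := mul_le_mul_of_nonneg_left (by linarith :
      inner ℝ v (γ t - x) - ε * ‖γ t - x‖ ≤ g (γ t) - g x) (inv_nonneg.2 ht.le)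
    linarith
  have hlim : Tendsto (fun ε : ℝ => inner ℝ v d - ε * ‖d‖) (𝓝[>] 0) (𝓝 (inner ℝ v d)) := by
    have : Continuous fun ε : ℝ => inner ℝ v d - ε * ‖d‖ := by fun_prop
    simpa using (this.tendsto 0).mono_left nhdsWithin_le_nhds
  exact le_of_tendsto hlim (by filter_upwards [self_mem_nhdsWithin] with ε hε using key ε hε)

/-- If `0` is a relative interior subgradient of a partly smooth function, then every sufficiently
small vector normal to the manifold is a subgradient. -/
theorem PartlySmoothAt.exists_normal_ball_subset {f : EuclideanSpace ℝ (Fin n) → EReal}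
    {M : Set (EuclideanSpace ℝ (Fin n))} {x : EuclideanSpace ℝ (Fin n)}
    (hps : PartlySmoothAt f M x) (hri : 0 ∈ intrinsicInterior ℝ (subdiff f x))
    {K : Submodule ℝ (EuclideanSpace ℝ (Fin n))} (hK : tangentConeAt ℝ M x ⊆ K)
    (hcurve : ∀ d ∈ K, ∃ γ : ℝ → EuclideanSpace ℝ (Fin n), γ 0 = x ∧ HasDerivAt γ d 0 ∧
      ∀ᶠ t in 𝓝 (0 : ℝ), γ t ∈ M) :
    ∃ δ > 0, ∀ w ∈ Kᗮ, ‖w‖ < δ → w ∈ subdiff f x := by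
  have h0 : 0 ∈ subdiff f x := intrinsicInterior_subset hri
  obtain ⟨hfin, -, hlsc, hreg, hhor⟩ := hps.regularity.self_of_nhdsWithin hps.manifold.1
  obtain ⟨U, g, hU, hxU, hg, hfg⟩ := hps.restricted_smoothness
  have hg' : HasFDerivAt g (fderiv ℝ g x) x :=
    ((hg.contDiffAt (hU.mem_nhds hxU)).differentiableAt one_ne_zero).hasFDerivAt
  have hle : ∀ v ∈ subdiff f x, ∀ d ∈ K, inner ℝ v d ≤ fderiv ℝ g x d := by
    intro v hv d hd
    obtain ⟨γ, hγ0, hγ, hγM⟩ := hcurve d hd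
    refine inner_le_of_mem_regSubdiff (hreg ▸ hv) hg' hγ0 hγ ?_
    have hc : Tendsto γ (𝓝 0) (𝓝 x) := hγ0 ▸ hγ.continuousAt.tendsto
    filter_upwards [hγM, hc.eventually (hU.mem_nhds hxU)] with t ht htU
    exact hfg _ ⟨ht, htU⟩
  have heq : ∀ v ∈ subdiff f x, ∀ d ∈ K, inner ℝ v d = fderiv ℝ g x d := by
    intro v hv d hd
    have := hle v hv (-d) (K.neg_mem hd)
    rw [inner_neg_right, map_neg] at this
    exact le_antisymm (hle v hv d hd) (by linarith)
  have hsubK : subdiff f x ⊆ Kᗮ := by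
    intro v hv
    refine (Submodule.mem_orthogonal' K v).2 fun d hd => ?_
    rw [heq v hv d hd, ← heq 0 h0 d hd, inner_zero_left]
  set L := Submodule.span ℝ (subdiff f x) with hL
  have hLK : L ≤ Kᗮ := Submodule.span_le.2 hsubK
  have hKL : Kᗮ ≤ L := by
    intro w hw
    -- The component `z` orthogonal to the span is still normal to `M`; sharpness must force it to
    -- vanish.
    obtain ⟨y, hy, z, hz, rfl⟩ := L.exists_add_mem_mem_orthogonal w
    by_contra hcon
    have hz0 : z ≠ 0 := fun h => hcon (by rw [h, add_zero]; exact hy)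
    have hzK : z ∈ Kᗮ := by
      have := Kᗮ.sub_mem hw (hLK hy)
      rwa [add_sub_cancel_left] at this
    have hzN : z ∈ normalSpace M x := fun d hd => (Submodule.mem_orthogonal' K z).1 hzK d (hK hd)
    have horth : ∀ v ∈ subdiff f x, inner ℝ v z = (0 : ℝ) := fun v hv =>
      (Submodule.mem_orthogonal L z).1 hz v (Submodule.subset_span hv)
    -- Regularity makes horizon subgradients recession directions; starting from the subgradient 0,
    -- they are themselves subgradients.
    have hhsub : ∀ v ∈ horizonSubdiff f x, v ∈ subdiff f x := by
      intro v hv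
      rw [hhor] at hv
      have := hv 0 (hreg ▸ h0) 1 zero_le_one
      rw [zero_add, one_smul] at this
      rwa [hreg]
    have h1 : subderiv f x z ≤ 0 := subderiv_nonpos hfin hlsc (fun v hv => (horth v hv).le)
      fun v hv => (horth v (hhsub v hv)).le
    have h2 : subderiv f x (-z) ≤ 0 := subderiv_nonpos hfin hlsc
      (fun v hv => by rw [inner_neg_right, horth v hv, neg_zero])
      fun v hv => by rw [inner_neg_right, horth v (hhsub v hv), neg_zero]
    have h3 := hps.normal_sharpness z hzN hz0
    have h4 : (0 : EReal) ≤ -subderiv f x z := EReal.le_neg_of_le_neg (by simpa using h1)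
    exact absurd (h4.trans_lt h3) (not_lt.2 h2)
  obtain ⟨y, hy, hy0⟩ := mem_intrinsicInterior.1 hri
  obtain ⟨δ, hδ, hball⟩ := Metric.mem_nhds_iff.1 (mem_interior_iff_mem_nhds.1 hy)
  refine ⟨δ, hδ, fun w hw hwδ => ?_⟩
  have hwA : w ∈ affineSpan ℝ (subdiff f x) := by
    -- As 0 is a subgradient, the affine span is the linear span, so the relative ball covers all
    -- short normals.
    have h := affineSpan_insert_zero (k := ℝ) (subdiff f x)
    rw [Set.insert_eq_of_mem h0] at h
    have hwL : w ∈ (L : Set (EuclideanSpace ℝ (Fin n))) := hKL hw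
    rw [hL, ← h] at hwL
    exact hwL
  have hmem : (⟨w, hwA⟩ : affineSpan ℝ (subdiff f x)) ∈ Metric.ball y δ := by
    rw [Metric.mem_ball, Subtype.dist_eq, hy0]
    simpa using hwδ
  exact hball hmem

/-! ### Hypomonotonicity and selections of subgradients -/

/-- If `f` is prox-regular at `x` for `v`, then an `f`-attentive localization of the subdifferential
around `(x, v)` is hypomonotone; this is its sequential form. -/
theorem ProxRegularFor.exists_inner_sub_le {f : EuclideanSpace ℝ (Fin n) → EReal}
    {x v : EuclideanSpace ℝ (Fin n)} (h : ProxRegularFor f x v) :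
    ∃ ρ > 0, ∀ y z u s : ℕ → EuclideanSpace ℝ (Fin n), Tendsto y atTop (𝓝 x) →
      Tendsto z atTop (𝓝 x) → Tendsto (fun k => f (y k)) atTop (𝓝 (f x)) →
      Tendsto (fun k => f (z k)) atTop (𝓝 (f x)) → ∀ᶠ k in atTop, u k ∈ subdiff f (y k) →
        s k ∈ subdiff f (z k) → u k ∈ Metric.ball v ρ → s k ∈ Metric.ball v ρ →
        inner ℝ (s k - u k) (y k - z k) ≤ ρ⁻¹ * ‖y k - z k‖ ^ 2 := by
  obtain ⟨hfin, -, ρ, hρ, ε, hε, hprox⟩ := h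
  obtain ⟨a, ha⟩ : ∃ a : ℝ, f x = a := ⟨_, hfin.coe_toReal.symm⟩
  -- One constant serves as radius and, inverted, as hypomonotonicity modulus; adding the two prox
  -- inequalities gives modulus ρ, at most this inverse.
  refine ⟨min ε ρ⁻¹, lt_min hε (inv_pos.2 hρ), fun y z u s hy hz hfy hfz => ?_⟩
  have hlo : f x - (ε : EReal) < f x := by
    rw [ha]; exact_mod_cast sub_lt_self a hε
  have hhi : f x < f x + (ε : EReal) := by
    rw [ha]; exact_mod_cast lt_add_of_pos_right a hε
  filter_upwards [hy.eventually (Metric.ball_mem_nhds x hε),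
    hz.eventually (Metric.ball_mem_nhds x hε), hfy.eventually_const_lt hlo,
    hfy.eventually_lt_const hhi, hfz.eventually_const_lt hlo, hfz.eventually_lt_const hhi]
    with k hyk hzk hy1 hy2 hz1 hz2 hu hs huρ hsρ
  have hbε := Metric.ball_subset_ball (x := v) (min_le_left ε ρ⁻¹)
  have h1 := hprox _ hyk _ hzk hy1 hy2 _ hu (hbε huρ)
  have h2 := hprox _ hzk _ hyk hz1 hz2 _ hs (hbε hsρ)
  rw [← hu.1.coe_toReal, ← hs.1.coe_toReal] at h1 h2
  norm_cast at h1 h2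
  have h3 : ρ ≤ (min ε ρ⁻¹)⁻¹ := by
    rw [le_inv_comm₀ hρ (lt_min hε (inv_pos.2 hρ))]
    exact min_le_right _ _
  have h4 := mul_le_mul_of_nonneg_right h3 (sq_nonneg ‖y k - z k‖)
  rw [← neg_sub (y k) (z k), inner_neg_right, norm_neg] at h1
  rw [inner_sub_left]
  linarith

/-- A selection converging to `0` from sets whose distance to `0` tends to zero. -/
theorem exists_tendsto_zero_of_infEDist {E : Type*} [SeminormedAddCommGroup E] {S : ℕ → Set E}
    (h : Tendsto (fun k => Metric.infEDist 0 (S k)) atTop (𝓝 (0 : ℝ≥0∞))) :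
    ∃ v : ℕ → E, (∀ᶠ k in atTop, v k ∈ S k) ∧ Tendsto v atTop (𝓝 0) := by
  have hex : ∀ k, ∃ v : E, Metric.infEDist 0 (S k) < ⊤ →
      v ∈ S k ∧ edist 0 v < Metric.infEDist 0 (S k) + ((k : ℝ≥0∞) + 1)⁻¹ := by
    intro k
    by_cases hk : Metric.infEDist 0 (S k) < ⊤
    · obtain ⟨v, hv, hlt⟩ := Metric.infEDist_lt_iff.1 (ENNReal.lt_add_right hk.ne
        (b := ((k : ℝ≥0∞) + 1)⁻¹) (by simp))
      exact ⟨v, fun _ => ⟨hv, hlt⟩⟩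
    · exact ⟨0, fun h => absurd h hk⟩
  choose v hv using hex
  have hfin : ∀ᶠ k in atTop, Metric.infEDist 0 (S k) < ⊤ := h.eventually_lt_const (by simp)
  refine ⟨v, hfin.mono fun k hk => (hv k hk).1, ?_⟩
  rw [tendsto_iff_edist_tendsto_0]
  have hlim : Tendsto (fun k : ℕ => Metric.infEDist 0 (S k) + ((k : ℝ≥0∞) + 1)⁻¹) atTop (𝓝 0) := by
    have h2 : Tendsto (fun k : ℕ => ((k : ℝ≥0∞) + 1)⁻¹) atTop (𝓝 0) := by
      simpa [Function.comp_def] using ENNReal.tendsto_inv_nat_nhds_zero.comp (tendsto_add_atTop_nat 1)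
    simpa using h.add h2
  refine tendsto_of_tendsto_of_tendsto_of_le_of_le' tendsto_const_nhds hlim
    (Eventually.of_forall fun _ => zero_le) (hfin.mono fun k hk => ?_)
  rw [edist_comm]
  exact (hv k hk).2.le

/-- Inner semicontinuity along sequences that lie in the set only eventually. -/
theorem SetContinuousRelAt.exists_tendsto
    {F : EuclideanSpace ℝ (Fin n) → Set (EuclideanSpace ℝ (Fin n))}
    {M : Set (EuclideanSpace ℝ (Fin n))} {x v : EuclideanSpace ℝ (Fin n)}
    (hF : SetContinuousRelAt F M x) (hx : x ∈ M) (hv : v ∈ F x)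
    {y : ℕ → EuclideanSpace ℝ (Fin n)} (hyM : ∀ᶠ k in atTop, y k ∈ M)
    (hy : Tendsto y atTop (𝓝 x)) :
    ∃ u : ℕ → EuclideanSpace ℝ (Fin n), (∀ᶠ k in atTop, u k ∈ F (y k)) ∧
      Tendsto u atTop (𝓝 v) := by
  classical
  -- The finitely many terms off `M` are replaced by `x`.
  have heq : (fun k => if y k ∈ M then y k else x) =ᶠ[atTop] y :=
    hyM.mono fun k hk => if_pos hk
  obtain ⟨u, hu, hlim⟩ := (hF (fun k => if y k ∈ M then y k else x)
    (fun k => by split_ifs with h <;> assumption) (hy.congr' heq.symm)).2 v hv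
  refine ⟨u, ?_, hlim⟩
  filter_upwards [hu, heq] with k hk hk'
  rwa [hk'] at hk

/-! ### Finite identification -/

/-- Finite identification of the manifold by approximately critical sequences. -/
theorem PartlySmoothAt.eventually_mem {f : EuclideanSpace ℝ (Fin n) → EReal}
    {M : Set (EuclideanSpace ℝ (Fin n))} {x : EuclideanSpace ℝ (Fin n)}
    (hps : PartlySmoothAt f M x) (hprox : ProxRegularFor f x 0)
    (hri : 0 ∈ intrinsicInterior ℝ (subdiff f x)) {y v : ℕ → EuclideanSpace ℝ (Fin n)}
    (hy : Tendsto y atTop (𝓝 x)) (hfy : Tendsto (fun k => f (y k)) atTop (𝓝 (f x)))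
    (hv : ∀ᶠ k in atTop, v k ∈ subdiff f (y k)) (hv0 : Tendsto v atTop (𝓝 0)) :
    ∀ᶠ k in atTop, y k ∈ M := by
  obtain ⟨K, hK, hcurve, hproj⟩ := hps.manifold.exists_tangentSpace
  obtain ⟨δ, hδ, hball⟩ := hps.exists_normal_ball_subset hri hK hcurve
  obtain ⟨ρ, hρ, hmono⟩ := hprox.exists_inner_sub_le
  obtain ⟨p, hpM, hpx, hnormal⟩ := hproj y hy
  by_contra hcon
  obtain ⟨ψ, hψ, hψM⟩ := extraction_of_frequently_atTop (not_eventually.1 hcon)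
  have hne : ∀ k, 0 < ‖y (ψ k) - p (ψ k)‖ := fun k =>
    norm_pos_iff.2 (sub_ne_zero.2 fun h => hψM k (h ▸ hpM _))
  obtain ⟨w, hw1, χ, hχ, hlim⟩ :=
    (isCompact_sphere (0 : EuclideanSpace ℝ (Fin n)) 1).tendsto_subseq
      (x := fun k => ‖y (ψ k) - p (ψ k)‖⁻¹ • (y (ψ k) - p (ψ k)))
      (fun k => by simp [norm_smul, (hne k).ne'])
  have hw1 : ‖w‖ = 1 := by simpa using hw1
  set φ : ℕ → ℕ := ψ ∘ χ with hφ_def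
  have hφ : StrictMono φ := hψ.comp hχ
  have hwK : w ∈ Kᗮ := hnormal φ (fun k => ‖y (φ k) - p (φ k)‖⁻¹) w hφ hlim
  -- Below δ, so that η w is a subgradient; below ρ, so that hypomonotonicity applies near it.
  set η : ℝ := min δ ρ / 2 with hη
  have hη0 : 0 < η := half_pos (lt_min hδ hρ)
  have hηδ : η < δ := by have := min_le_left δ ρ; have := lt_min hδ hρ; linarith
  have hηρ : η < ρ := by have := min_le_right δ ρ; have := lt_min hδ hρ; linarith
  have hnorm : ‖η • w‖ = η := by rw [norm_smul, hw1, mul_one, Real.norm_of_nonneg hη0.le]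
  have hηw : η • w ∈ subdiff f x := hball _ (Kᗮ.smul_mem η hwK) (by rwa [hnorm])
  have hφt := hφ.tendsto_atTop
  obtain ⟨u, hu, hulim⟩ := hps.subgradient_continuity.exists_tendsto hps.manifold.1 hηw
    (Eventually.of_forall fun k => hpM (φ k)) (hpx.comp hφt)
  -- Hypomonotonicity also requires convergence of values, supplied by smoothness along `M`.
  have hfp : Tendsto (fun k => f (p (φ k))) atTop (𝓝 (f x)) := by
    obtain ⟨U, g, hU, hxU, hg, hfg⟩ := hps.restricted_smoothness
    rw [hfg x ⟨hps.manifold.1, hxU⟩]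
    have hgc : Tendsto (fun k => (g (p (φ k)) : EReal)) atTop (𝓝 (g x)) :=
      (continuous_coe_real_ereal.tendsto _).comp
        ((hg.continuousOn.continuousAt (hU.mem_nhds hxU)).tendsto.comp (hpx.comp hφt))
    refine hgc.congr' ?_
    filter_upwards [(hpx.comp hφt).eventually (hU.mem_nhds hxU)] with k hk
    exact (hfg _ ⟨hpM _, hk⟩).symm
  have hineq := hmono (y ∘ φ) (p ∘ φ) (v ∘ φ) u (hy.comp hφt) (hpx.comp hφt) (hfy.comp hφt) hfp
  have hvlim : Tendsto (v ∘ φ) atTop (𝓝 0) := hv0.comp hφt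
  have hleft := (hulim.sub hvlim).inner (𝕜 := ℝ) hlim
  have hright : Tendsto (fun k => ρ⁻¹ * ‖y (φ k) - p (φ k)‖) atTop (𝓝 0) := by
    simpa using (((hy.comp hφt).sub (hpx.comp hφt)).norm).const_mul ρ⁻¹
  have hle := le_of_tendsto_of_tendsto hleft hright (by
    filter_upwards [hineq, hφt.eventually hv, hu,
      hvlim.eventually (Metric.ball_mem_nhds 0 hρ),
      hulim.eventually (Metric.isOpen_ball.mem_nhds (x := η • w) (s := Metric.ball 0 ρ)
        (by simpa [hnorm] using hηρ))] with k hk hvk huk hvρ huρ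
    have h := hk hvk huk hvρ huρ
    have hpos : 0 < ‖y (φ k) - p (φ k)‖ := hne (χ k)
    change inner ℝ (u k - v (φ k)) (‖y (φ k) - p (φ k)‖⁻¹ • (y (φ k) - p (φ k))) ≤
      ρ⁻¹ * ‖y (φ k) - p (φ k)‖
    rw [real_inner_smul_right, inv_mul_le_iff₀ hpos]
    refine h.trans (le_of_eq ?_)
    simp only [Function.comp_apply]
    ring)
  -- The limit inequality reads η‖w‖² ≤ 0 with ‖w‖ = 1.
  rw [sub_zero, real_inner_smul_left, real_inner_self_eq_norm_sq, hw1] at hle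
  linarith

end VarAnalysis


theorem mainTheorem3 (n : ℕ) (f : EuclideanSpace ℝ (Fin n) → EReal)
    (M : Set (EuclideanSpace ℝ (Fin n))) (xbar : EuclideanSpace ℝ (Fin n))
    (hps : VarAnalysis.PartlySmoothAt f M xbar)
    (hprox : VarAnalysis.ProxRegularAt f xbar)
    (hri : (0 : EuclideanSpace ℝ (Fin n)) ∈ intrinsicInterior ℝ (VarAnalysis.subdiff f xbar))
    (x : ℕ → EuclideanSpace ℝ (Fin n))
    (hx : Tendsto x atTop (𝓝 xbar))
    (hfx : Tendsto (fun k => f (x k)) atTop (𝓝 (f xbar))) :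
    (∀ᶠ k in atTop, x k ∈ M) ↔
      Tendsto (fun k => Metric.infEDist 0 (VarAnalysis.subdiff f (x k))) atTop (𝓝 (0 : ℝ≥0∞)) := by
  have h0 : 0 ∈ VarAnalysis.subdiff f xbar := intrinsicInterior_subset hri
  constructor
  · intro hM
    obtain ⟨u, hu, hlim⟩ := hps.subgradient_continuity.exists_tendsto hps.manifold.1 h0 hM hx
    refine tendsto_of_tendsto_of_tendsto_of_le_of_le' tendsto_const_nhds
      (tendsto_iff_edist_tendsto_0.1 hlim) (Eventually.of_forall fun _ => zero_le)
      (hu.mono fun k hk => ?_)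
    rw [edist_comm]
    exact Metric.infEDist_le_edist_of_mem hk
  · intro hdist
    obtain ⟨v, hv, hv0⟩ := VarAnalysis.exists_tendsto_zero_of_infEDist hdist
    exact hps.eventually_mem (hprox 0 h0) hri hx hfx hv hv0
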